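/- Let $0<\alpha<1$, $L>0$, let $J,N\ge 1$ be integers, $h=L/J$, and let $0=t_0<t_1<\dots<t_N$ be arbitrary time levels with steps $k_n=t_n-t_{n-1}$. For a time-indexed sequence $W^n$ put $\delta_tW^{n-\frac12}=(W^n-W^{n-1})/k_n$, $W^{n-\frac12}=\frac12(W^n+W^{n-1})$, and $$I^{(\alpha)}W^{n-\frac12}=\widehat w_{n1}W^1k_1+\sum_{s=2}^{n}\widehat w_{ns}W^{s-\frac12}k_s,\qquad \widehat w_{ns}=\frac1{k_nk_s}\int_{t_{n-1}}^{t_n}\int_{t_{s-1}}^{\min\{t,t_s\}}\frac{(t-\zeta)^{\alpha-1}}{\Gamma(\alpha)}\,d\zeta\,dt .$$ For a spatial grid function $W_0,\dots,W_J$ put $\nabla W_j=\frac13(W_{j-1}+W_j+W_{j+1})$, $\Delta_xW_j=\frac1{2h}(W_{j+1}-W_{j-1})$ and $\delta_x^2W_j=\frac1{h^2}(W_{j+1}-2W_j+W_{j-1})$. Theorem. For arbitrary real source values $f_j^{n-\frac12}$ ($1\le j\le J-1$, $1\le n\le N$) and any initial vector $U^0=(U^0_1,\dots,U^0_{J-1})\in\mathbb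 R^{J-1}$, there exist $U^1,\dots,U^N$, with boundary values $U^n_0=U^n_J=0$ for $1\le n\le N$, that satisfy the nonlinear implicit difference equations $$\delta_tU_j^{\frac12}+\nabla U_j^1\,\Delta_xU_j^1=I^{(\alpha)}\delta_x^2U_j^{\frac12}+f_j^{\frac12},\qquad 1\le j\le J-1,$$ $$\delta_tU_j^{n-\frac12}+\nabla U_j^{n-\frac12}\,\Delta_xU_j^{n-\frac12}=I^{(\alpha)}\delta_x^2U_j^{n-\frac12}+f_j^{n-\frac12},\qquad 1\le j\le J-1,\ 2\le n\le N.$$ -/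

import Mathlib

noncomputable section

namespace PIDEScheme

/-- The Abel kernel `β(t) = t^(α-1) / Γ(α)`. -/
def abelKernel (α t : ℝ) : ℝ := t ^ (α - 1) / Real.Gamma α

/-! Time levels `t 0 < t 1 < ... < t N`.  All functions of a time index `n` below are used for
`1 ≤ n` only. -/

/-- The step `k_n = t_n - t_{n-1}`. -/
def timeStep (t : ℕ → ℝ) (n : ℕ) : ℝ := t n - t (n - 1)

/-- The difference quotient `δ_t W^{n-1/2} = (W^n - W^{n-1}) / k_n`. -/
def timeDiff (t W : ℕ → ℝ) (n : ℕ) : ℝ := (W n - W (n - 1)) / timeStep t n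

/-- The average `W^{n-1/2} = (W^n + W^{n-1}) / 2`. -/
def timeAvg (W : ℕ → ℝ) (n : ℕ) : ℝ := (W n + W (n - 1)) / 2

/-- The product-integration weights
`ŵ_{ns} = 1 / (k_n k_s) ∫_{t_{n-1}}^{t_n} ∫_{t_{s-1}}^{min (τ, t_s)} β(τ - ζ) dζ dτ`
for `1 ≤ s ≤ n`. -/
def weight (α : ℝ) (t : ℕ → ℝ) (n s : ℕ) : ℝ :=
  (1 / (timeStep t n * timeStep t s)) *
    ∫ τ in (t (n - 1))..(t n), ∫ ζ in (t (s - 1))..(min τ (t s)), abelKernel α (τ - ζ)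

/-- The discrete fractional integral
`I^(α) W^{n-1/2} = ŵ_{n1} W^1 k_1 + ∑_{s=2}^n ŵ_{ns} W^{s-1/2} k_s`. -/
def discreteFracInt (α : ℝ) (t W : ℕ → ℝ) (n : ℕ) : ℝ :=
  weight α t n 1 * W 1 * timeStep t 1
    + ∑ s ∈ Finset.Icc 2 n, weight α t n s * timeAvg W s * timeStep t s

/-! Spatial grid functions `W_0, ..., W_J`; the operators at `j` are used for `1 ≤ j ≤ J - 1`. -/

/-- The centred difference `Δ_x W_j = (W_{j+1} - W_{j-1}) / (2h)`. -/
def centralDiff (h : ℝ) (W : ℕ → ℝ) (j : ℕ) : ℝ := (W (j + 1) - W (j - 1)) / (2 * h)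

/-- The backward difference `δ_x W_{j-1/2} = (W_j - W_{j-1}) / h`. -/
def backwardDiff (h : ℝ) (W : ℕ → ℝ) (j : ℕ) : ℝ := (W j - W (j - 1)) / h

/-- The second difference `δ_x² W_j = (δ_x W_{j+1/2} - δ_x W_{j-1/2}) / h`. -/
def secondDiff (h : ℝ) (W : ℕ → ℝ) (j : ℕ) : ℝ :=
  (backwardDiff h W (j + 1) - backwardDiff h W j) / h

/-- The three-point mean `∇W_j = (W_{j-1} + W_j + W_{j+1}) / 3`. -/
def threePointMean (W : ℕ → ℝ) (j : ℕ) : ℝ := (W (j - 1) + W j + W (j + 1)) / 3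

/-- `U n j` (with `0 ≤ n ≤ N`, `0 ≤ j ≤ J`) solves the fully discrete implicit scheme with
spatial step `h`, time levels `t`, source values `f n j` standing for `f_j^{n-1/2}`,
initial vector `U0` at the interior nodes and homogeneous Dirichlet boundary values.
Values of `U` at other indices play no role. -/
structure IsSolution (α h : ℝ) (J N : ℕ) (t : ℕ → ℝ) (f : ℕ → ℕ → ℝ)
    (U0 : Fin (J - 1) → ℝ) (U : ℕ → ℕ → ℝ) : Prop where
  initial : ∀ i : Fin (J - 1), U 0 ((i : ℕ) + 1) = U0 i
  boundary : ∀ n, 1 ≤ n → n ≤ N → U n 0 = 0 ∧ U n J = 0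
  first_level : ∀ j, 1 ≤ j → j ≤ J - 1 →
    timeDiff t (fun m => U m j) 1 + threePointMean (U 1) j * centralDiff h (U 1) j
      = discreteFracInt α t (fun m => secondDiff h (U m) j) 1 + f 1 j
  later_levels : ∀ n, 2 ≤ n → n ≤ N → ∀ j, 1 ≤ j → j ≤ J - 1 →
    timeDiff t (fun m => U m j) n
        + threePointMean (fun i => timeAvg (fun m => U m i) n) j
          * centralDiff h (fun i => timeAvg (fun m => U m i) n) j
      = discreteFracInt α t (fun m => secondDiff h (U m) j) n + f n j

end PIDEScheme

end

/-! Each time level is one nonlinear system a W + ∇W Δ_x W = c δ_x² W + g for W vanishing at both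
ends, with a > 0, c ≥ 0 and g built from earlier levels. The unknown is U^1 at the first level and
the midpoint U^{n-1/2} afterwards; only the diagonal weight multiplies it. Paired with W, convection
telescopes to zero and δ_x² is nonpositive, so the residual F satisfies ⟨F(W), W⟩ ≥ a‖W‖² - ‖g‖‖W‖,
which is positive for large ‖W‖.

A C¹ field pointing outwards far away has a zero: otherwise, blending it with the identity and
normalizing gives a C¹ retraction r onto a sphere. This is excluded by volume. The integral of det(1
+ s D(r - id)) over the ball is polynomial in s and equals the volume for small s, yet it vanishes
at s = 1. -/

section NoRetraction

/-! ### No C¹ retraction onto a sphere; zeros of outward-pointing fields. -/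

open MeasureTheory Metric Polynomial
open scoped NNReal

/-- For fixed distinct nodes `v i`, the determinant of `1 + A` is a fixed affine combination of the
determinants of `1 + v i • A`. -/
theorem exists_weights_det_one_add {E : Type*} [NormedAddCommGroup E] [NormedSpace ℝ E]
    [FiniteDimensional ℝ E] (v : Fin (Module.finrank ℝ E + 1) → ℝ) (hv : Function.Injective v) :
    ∃ w : Fin (Module.finrank ℝ E + 1) → ℝ, ∑ i, w i = 1 ∧
      ∀ A : E →L[ℝ] E, (1 + A).det = ∑ i, w i * (1 + v i • A).det := by
  classical
  refine ⟨fun i => (Lagrange.basis Finset.univ v i).eval 1, ?_, fun A => ?_⟩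
  · rw [← eval_finsetSum, Lagrange.sum_basis hv.injOn Finset.univ_nonempty, eval_one]
  · let b := Module.finBasis ℝ E
    let M := LinearMap.toMatrix b b (A : E →ₗ[ℝ] E)
    -- As a function of s, det(1 + s A) is a polynomial of degree at most dim E, so its value at 1
    -- is interpolated from dim E + 1 nodes.
    let p : ℝ[X] := ((X : ℝ[X]) • M.map C + (1 : Matrix _ _ ℝ).map C).det
    have hp : ∀ s : ℝ, p.eval s = (1 + s • A).det := by
      intro s
      have h1 : p.eval s = (s • M + 1).det := by
        simp only [p]
        rw [← coe_evalRingHom, RingHom.map_det]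
        congr 1
        ext i j
        by_cases hij : i = j
        · subst hij
          simp
          ring
        · simp [Matrix.one_apply_ne hij]
          ring
      rw [h1, ContinuousLinearMap.det, ← LinearMap.det_toMatrix b, add_comm]
      congr 1
      simp only [ContinuousLinearMap.toLinearMap_add, ContinuousLinearMap.toLinearMap_smul, map_add,
        map_smul, M]
      congr 1
      exact (LinearMap.toMatrix_one b).symm
    have hdeg : p.degree < (Finset.univ : Finset (Fin (Module.finrank ℝ E + 1))).card := by
      refine lt_of_le_of_lt degree_le_natDegree ?_
      have := natDegree_det_X_add_C_le M (1 : Matrix _ _ ℝ)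
      rw [Fintype.card_fin] at this
      rw [Finset.card_univ, Fintype.card_fin]
      exact_mod_cast Nat.lt_succ_of_le this
    have h1 := hp 1
    rw [one_smul] at h1
    rw [← h1]
    conv_lhs => rw [Lagrange.eq_interpolate hv.injOn hdeg]
    rw [Lagrange.interpolate_apply, eval_finsetSum]
    refine Finset.sum_congr rfl fun i _ => ?_
    rw [eval_mul, eval_C, hp, mul_comm]

/-- Used to extend a map that is Lipschitz on a ball to a globally Lipschitz one. The constant 2 is
valid in every normed space, and its size is immaterial. -/
theorem lipschitzWith_radial_projection {E : Type*} [NormedAddCommGroup E] [NormedSpace ℝ E]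
    {S : ℝ} (hS : 0 < S) :
    LipschitzWith 2 fun x : E => (S / max S ‖x‖) • x := by
  refine LipschitzWith.of_dist_le_mul fun x y => ?_
  rw [dist_eq_norm, dist_eq_norm]
  set a := max S ‖x‖
  set b := max S ‖y‖
  have ha : S ≤ a := le_max_left _ _
  have hb : S ≤ b := le_max_left _ _
  have hyb : ‖y‖ ≤ b := le_max_right _ _
  have ha0 : 0 < a := hS.trans_le ha
  have hb0 : 0 < b := hS.trans_le hb
  have hab : |b - a| ≤ ‖x - y‖ := by
    have h1 : |b - a| ≤ |‖y‖ - ‖x‖| := by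
      simpa [a, b] using abs_max_sub_max_le_max S ‖y‖ S ‖x‖
    rw [norm_sub_rev]
    exact h1.trans (abs_norm_sub_norm_le y x)
  have key : (S / a) • x - (S / b) • y = (S / a) • (x - y) + (S * (b - a) / (a * b)) • y := by
    have : S * (b - a) / (a * b) = S / a - S / b := by field_simp
    rw [this, smul_sub, sub_smul]
    abel
  rw [key]
  refine (norm_add_le _ _).trans ?_
  rw [norm_smul, norm_smul, Real.norm_eq_abs, Real.norm_eq_abs, abs_of_pos (div_pos hS ha0),
    abs_div, abs_mul, abs_of_pos hS, abs_of_pos (mul_pos ha0 hb0)]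
  have h1 : S / a * ‖x - y‖ ≤ 1 * ‖x - y‖ :=
    mul_le_mul_of_nonneg_right ((div_le_one ha0).2 ha) (norm_nonneg _)
  have h2 : S * |b - a| / (a * b) * ‖y‖ ≤ 1 * ‖x - y‖ := by
    have : S * |b - a| / (a * b) * ‖y‖ = (S / a) * (‖y‖ / b) * |b - a| := by field_simp
    rw [this]
    refine mul_le_mul ?_ hab (abs_nonneg _) zero_le_one
    exact mul_le_one₀ ((div_le_one ha0).2 ha) (by positivity) ((div_le_one hb0).2 hyb)
  simp only [NNReal.coe_ofNat]
  linarith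

/-- A small Lipschitz perturbation of the identity is bijective. -/
theorem bijective_id_add_smul {E : Type*} [NormedAddCommGroup E] [NormedSpace ℝ E]
    [CompleteSpace E] {g : E → E} {K : ℝ≥0} (hg : LipschitzWith K g) {s : ℝ≥0} (hs : s * K < 1) :
    Function.Bijective fun x => x + (s : ℝ) • g x := by
  have happ : ApproximatesLinearOn (fun x => x + (s : ℝ) • g x)
      ((ContinuousLinearEquiv.refl ℝ E : E ≃L[ℝ] E) : E →L[ℝ] E) Set.univ (s * K) := by
    rw [ApproximatesLinearOn.approximatesLinearOn_iff_lipschitzOnWith, lipschitzOnWith_univ]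
    refine LipschitzWith.of_dist_le_mul fun x y => ?_
    have := hg.dist_le_mul x y
    simp only [Pi.sub_apply, ContinuousLinearEquiv.coe_coe, ContinuousLinearEquiv.refl_apply,
      add_sub_cancel_left, dist_smul₀, Real.norm_eq_abs, NNReal.abs_eq, NNReal.coe_mul]
    rw [mul_assoc]
    gcongr
  have hc : Subsingleton E ∨
      s * K < ‖((ContinuousLinearEquiv.refl ℝ E).symm : E →L[ℝ] E)‖₊⁻¹ := by
    rcases subsingleton_or_nontrivial E with h | h
    · exact Or.inl h
    · right
      have : ‖((ContinuousLinearEquiv.refl ℝ E).symm : E →L[ℝ] E)‖₊ = 1 := by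
        ext
        exact ContinuousLinearMap.norm_id
      rw [this]
      simpa using hs
  exact ⟨Set.injOn_univ.1 (happ.injOn hc), happ.surjective hc⟩

/-- Every 1 + s A with 0 ≤ s ≤ 1 is invertible (Neumann series), so the determinant cannot change
sign from its value 1 at s = 0. -/
theorem det_one_add_pos_of_norm_lt_one {E : Type*} [NormedAddCommGroup E] [NormedSpace ℝ E]
    [FiniteDimensional ℝ E] (A : E →L[ℝ] E) (hA : ‖A‖ < 1) : 0 < (1 + A).det := by
  have : CompleteSpace E := FiniteDimensional.complete ℝ E
  have hne : ∀ s ∈ Set.Icc (0 : ℝ) 1, (1 + s • A).det ≠ 0 := by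
    intro s hs
    have h1 : ‖-(s • A)‖ < 1 := by
      rw [norm_neg, norm_smul, Real.norm_eq_abs, abs_of_nonneg hs.1]
      nlinarith [hs.2, norm_nonneg A]
    have h2 := isUnit_one_sub_of_norm_lt_one h1
    rw [sub_neg_eq_add] at h2
    have h3 : IsUnit ((1 + s • A : E →L[ℝ] E) : E →ₗ[ℝ] E) :=
      h2.map (ContinuousLinearMap.toLinearMapRingHom (R₁ := ℝ) (M₁ := E))
    exact (LinearMap.isUnit_iff_isUnit_det _).1 h3 |>.ne_zero
  have hcont : ContinuousOn (fun s : ℝ => (1 + s • A).det) (Set.Icc 0 1) :=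
    (ContinuousLinearMap.continuous_det.comp (by fun_prop)).continuousOn
  by_contra hneg
  have h0 : (1 + (0 : ℝ) • A).det = 1 := by
    rw [zero_smul, add_zero]
    exact LinearMap.det_id
  have := intermediate_value_Icc' zero_le_one hcont
  obtain ⟨s, hs, hs0⟩ := this (show (0 : ℝ) ∈ _ from
    ⟨by simpa using not_lt.1 hneg, by simp only [h0]; exact zero_le_one⟩)
  exact hne s hs hs0

variable {E : Type*} [NormedAddCommGroup E] [InnerProductSpace ℝ E] [FiniteDimensional ℝ E]
  [MeasurableSpace E] [BorelSpace E]

/-- For small s, x + s g(x) maps the ball bijectively onto itself with positive Jacobian, so this is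
the change of variables formula. -/
theorem exists_setIntegral_det_eq_volume {g : E → E} (hg : ContDiff ℝ 1 g) {S : ℝ} (hS : 0 < S)
    (hg0 : ∀ x, ‖x‖ = S → g x = 0) :
    ∃ ε : ℝ, 0 < ε ∧ ∀ s ∈ Set.Icc 0 ε,
      ∫ x in closedBall (0 : E) S, (1 + s • fderiv ℝ g x).det
        = volume.real (closedBall (0 : E) S) := by
  have hcd : Continuous (fderiv ℝ g) := hg.continuous_fderiv one_ne_zero
  have hd : Differentiable ℝ g := hg.differentiable one_ne_zero
  obtain ⟨K, hK⟩ := (isCompact_closedBall (0 : E) S).exists_bound_of_continuousOn hcd.continuousOn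
  lift max K 1 to ℝ≥0 using (zero_le_one.trans (le_max_right _ _)) with C hC
  have hC1 : 1 ≤ (C : ℝ) := hC ▸ le_max_right _ _
  have hKC : ∀ x ∈ closedBall (0 : E) S, ‖fderiv ℝ g x‖ ≤ C := fun x hx =>
    (hK x hx).trans (hC ▸ le_max_left _ _)
  have hlip : LipschitzOnWith C g (closedBall 0 S) :=
    (convex_closedBall 0 S).lipschitzOnWith_of_nnnorm_fderiv_le (fun x _ => hd x)
      (fun x hx => by exact_mod_cast hKC x hx)
  have hmaps : ∀ x : E, (S / max S ‖x‖) • x ∈ closedBall (0 : E) S := by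
    intro x
    have h0 : 0 < max S ‖x‖ := lt_max_of_lt_left hS
    rw [mem_closedBall_zero_iff, norm_smul, Real.norm_eq_abs, abs_of_pos (div_pos hS h0),
      div_mul_eq_mul_div, div_le_iff₀ h0]
    exact mul_le_mul_of_nonneg_left (le_max_right _ _) hS.le
  have hlipP : LipschitzWith (C * 2) fun x : E => g ((S / max S ‖x‖) • x) := by
    rw [← lipschitzOnWith_univ]
    exact hlip.comp (lipschitzWith_radial_projection hS).lipschitzOnWith (fun x _ => hmaps x)
  -- With this ε, s · 2C ≤ 1/2 gives bijectivity of the extended map and s · C ≤ 1/4 gives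
  -- positivity of the determinant.
  refine ⟨1 / (4 * C), by positivity, fun s hs => ?_⟩
  lift s to ℝ≥0 using hs.1
  have hsC : (s : ℝ) * C ≤ 1 / 4 := by
    have := mul_le_mul_of_nonneg_right hs.2 C.coe_nonneg
    refine this.trans (le_of_eq ?_)
    field_simp
  have hbij := bijective_id_add_smul hlipP (s := s) (by
    rw [← NNReal.coe_lt_coe]; push_cast; linarith)
  have hin : ∀ x ∈ closedBall (0 : E) S, (S / max S ‖x‖) • x = x := by
    intro x hx
    rw [mem_closedBall_zero_iff] at hx
    rw [max_eq_left hx, div_self hS.ne', one_smul]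
  have hout : ∀ x ∉ closedBall (0 : E) S, x + (s : ℝ) • g ((S / max S ‖x‖) • x) = x := by
    intro x hx
    rw [mem_closedBall_zero_iff, not_le] at hx
    rw [max_eq_right hx.le, hg0, smul_zero, add_zero]
    have : 0 < ‖x‖ := hS.trans hx
    rw [norm_smul, Real.norm_eq_abs, abs_of_pos (div_pos hS this), div_mul_cancel₀ _ this.ne']
  have himage : (fun x => x + (s : ℝ) • g x) '' closedBall (0 : E) S = closedBall (0 : E) S := by
    have h1 : (fun x => x + (s : ℝ) • g x) '' closedBall (0 : E) S =
        (fun x => x + (s : ℝ) • g ((S / max S ‖x‖) • x)) '' closedBall (0 : E) S :=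
      Set.image_congr fun x hx => by rw [hin x hx]
    -- The extended map is a bijection of E fixing every point outside the ball, so it must preserve
    -- the ball.
    rw [h1, ← compl_inj_iff, ← Set.image_compl_eq hbij]
    exact (Set.image_congr fun x hx => hout x hx).trans (Set.image_id' _)
  have hinj : Set.InjOn (fun x => x + (s : ℝ) • g x) (closedBall (0 : E) S) := by
    intro x hx y hy hxy
    apply hbij.1
    simpa only [hin x hx, hin y hy] using hxy
  have hder : ∀ x ∈ closedBall (0 : E) S, HasFDerivWithinAt (fun x => x + (s : ℝ) • g x)
      (1 + (s : ℝ) • fderiv ℝ g x) (closedBall (0 : E) S) x := fun x _ =>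
    ((hasFDerivAt_id x).add ((hd x).hasFDerivAt.const_smul (s : ℝ))).hasFDerivWithinAt
  have hcov := integral_image_eq_integral_abs_det_fderiv_smul volume
    (isClosed_closedBall (x := (0 : E)) (ε := S)).measurableSet hder hinj (fun _ => (1 : ℝ))
  rw [himage] at hcov
  simp only [smul_eq_mul, mul_one, integral_const, measureReal_restrict_apply_univ] at hcov
  rw [hcov]
  refine setIntegral_congr_fun isClosed_closedBall.measurableSet fun x hx => ?_
  refine (abs_of_pos (det_one_add_pos_of_norm_lt_one _ ?_)).symm
  rw [norm_smul, Real.norm_eq_abs, NNReal.abs_eq]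
  have := mul_le_mul_of_nonneg_left (hKC x hx) s.coe_nonneg
  linarith

/-- There is no `C¹` retraction of a ball onto its boundary sphere. -/
theorem not_exists_contDiff_retraction {r : E → E} (hr : ContDiff ℝ 1 r) {S : ℝ} (hS : 0 < S)
    (hnorm : ∀ x, ‖r x‖ = S) (hfix : ∀ x, ‖x‖ = S → r x = x) : False := by
  have hd : Differentiable ℝ r := hr.differentiable one_ne_zero
  obtain ⟨ε, hε, hvol⟩ := exists_setIntegral_det_eq_volume (g := fun x => r x - x)
    (hr.sub contDiff_id) hS (fun x hx => by rw [hfix x hx, sub_self])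
  have hfd : ∀ x, fderiv ℝ (fun x => r x - x) x = fderiv ℝ r x - 1 := fun x =>
    ((hd x).hasFDerivAt.sub (hasFDerivAt_id x)).fderiv
  set n := Module.finrank ℝ E
  -- Distinct nodes in [0, ε], where the integral is known to be the volume.
  let v : Fin (n + 1) → ℝ := fun i => ε * ((i : ℕ) / (n + 1 : ℝ))
  have hv : Function.Injective v := by
    intro i j hij
    have h1 : ((i : ℕ) / (n + 1 : ℝ)) = ((j : ℕ) / (n + 1 : ℝ)) := mul_left_cancel₀ hε.ne' hij
    have h2 : ((i : ℕ) : ℝ) = (j : ℕ) := by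
      have : (n + 1 : ℝ) ≠ 0 := by positivity
      field_simp at h1
      exact h1
    exact Fin.ext (by exact_mod_cast h2)
  have hvI : ∀ i, v i ∈ Set.Icc 0 ε := by
    intro i
    refine ⟨by positivity, mul_le_of_le_one_right hε.le ?_⟩
    rw [div_le_one (by positivity)]
    exact_mod_cast i.2.le
  obtain ⟨w, hw1, hw⟩ := exists_weights_det_one_add (E := E) v hv
  -- Constancy of ‖r‖ makes the range of Dr(x) orthogonal to r(x) ≠ 0, so Dr(x) is not surjective.
  have hdet0 : ∀ x, (1 + fderiv ℝ (fun x => r x - x) x).det = 0 := by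
    intro x
    rw [hfd, add_sub_cancel]
    by_contra hne
    have hunit : IsUnit (fderiv ℝ r x : E →ₗ[ℝ] E) :=
      (LinearMap.isUnit_iff_isUnit_det _).2 (isUnit_iff_ne_zero.2 hne)
    obtain ⟨u, hu⟩ := ((Module.End.isUnit_iff _).1 hunit).2 (r x)
    have hconst : (fun y => inner ℝ (r y) (r y)) = fun _ => S ^ 2 := by
      funext y
      rw [real_inner_self_eq_norm_sq, hnorm]
    have h1 := ((hd x).hasFDerivAt.inner ℝ (hd x).hasFDerivAt)
    rw [hconst] at h1
    have h2 := congrArg (fun T => T u) (h1.unique (hasFDerivAt_const (S ^ 2) x))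
    have hu' : fderiv ℝ r x u = r x := hu
    simp [hu', hnorm] at h2
    exact hS.ne' h2
  have hcd : Continuous (fderiv ℝ fun x => r x - x) :=
    (hr.sub contDiff_id).continuous_fderiv one_ne_zero
  have hzero : ∫ x in closedBall (0 : E) S, (1 + fderiv ℝ (fun x => r x - x) x).det = 0 := by
    simp only [hdet0, integral_zero]
  -- The zero integral at s = 1 is a combination, with weights summing to 1, of integrals all equal
  -- to the volume.
  rw [funext fun x => hw (fderiv ℝ (fun x => r x - x) x), integral_finsetSum] at hzero
  · simp only [integral_const_mul, hvol _ (hvI _)] at hzero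
    rw [← Finset.sum_mul, hw1, one_mul] at hzero
    have : 0 < volume.real (closedBall (0 : E) S) :=
      ENNReal.toReal_pos (measure_closedBall_pos volume _ hS).ne' measure_closedBall_lt_top.ne
    exact this.ne' hzero
  · intro i _
    refine ContinuousOn.integrableOn_compact (isCompact_closedBall _ _) (Continuous.continuousOn ?_)
    refine continuous_const.mul (ContinuousLinearMap.continuous_det.comp ?_)
    fun_prop

/-- A `C¹` vector field that points outwards outside a ball has a zero. -/
theorem exists_zero_of_inner_pos {F : E → E} (hF : ContDiff ℝ 1 F) (R : ℝ)
    (hpos : ∀ x, R ≤ ‖x‖ → 0 < inner ℝ (F x) x) : ∃ x, F x = 0 := by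
  by_contra! hne
  let χ : ContDiffBump (0 : E) := ⟨|R| + 1, |R| + 2, by positivity, by linarith⟩
  -- G is F on the ball of radius |R| + 1 and the identity from radius |R| + 2 on. In between, ⟨G x,
  -- x⟩ is a convex combination of positive numbers.
  let G : E → E := fun x => χ x • F x + (1 - χ x) • x
  have hχ : ContDiff ℝ 1 χ := χ.contDiff
  have hG : ContDiff ℝ 1 G := (hχ.smul hF).add ((contDiff_const.sub hχ).smul contDiff_id)
  have hG0 : ∀ x, G x ≠ 0 := by
    intro x
    by_cases hx : ‖x‖ ≤ |R| + 1
    · have h1 : χ x = 1 := χ.one_of_mem_closedBall (mem_closedBall_zero_iff.2 hx)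
      simp only [G, h1, one_smul, sub_self, zero_smul, add_zero]
      exact hne x
    · intro h0
      push Not at hx
      have hR := le_abs_self R
      have h1 := hpos x (by linarith)
      have h2 : inner ℝ (G x) x = 0 := by rw [h0, inner_zero_left]
      simp only [G, inner_add_left, real_inner_smul_left, real_inner_self_eq_norm_sq] at h2
      have h3 : 0 < ‖x‖ := by have := abs_nonneg R; linarith
      have h4 := χ.nonneg' x
      have h5 := χ.le_one (x := x)
      have h6 : 0 < ‖x‖ ^ 2 := by positivity
      rcases h4.eq_or_lt with h | h
      · rw [← h] at h2
        simp only [zero_mul, sub_zero, one_mul, zero_add] at h2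
        exact h6.ne' h2
      · have := mul_pos h h1
        have := mul_nonneg (sub_nonneg.2 h5) h6.le
        linarith
  have hS : 0 < |R| + 2 := by positivity
  refine not_exists_contDiff_retraction (r := fun x => (|R| + 2) • (‖G x‖⁻¹ • G x)) ?_ hS ?_ ?_
  · exact contDiff_const.smul (((hG.norm ℝ hG0).inv fun x => norm_ne_zero_iff.2 (hG0 x)).smul hG)
  · intro x
    rw [norm_smul, norm_smul, norm_inv, norm_norm, inv_mul_cancel₀ (norm_ne_zero_iff.2 (hG0 x)),
      mul_one, Real.norm_eq_abs, abs_of_pos hS]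
  · intro x hx
    have h1 : χ x = 0 := χ.zero_of_le_dist (by rw [dist_zero_right, hx])
    simp only [G, h1, zero_smul, zero_add, sub_zero, one_smul, hx]
    rw [smul_smul, mul_inv_cancel₀ hS.ne', one_smul]

end NoRetraction

/-! ### Discrete energy estimates and solvability of one time level. -/

namespace PIDEScheme

theorem abelKernel_nonneg {α : ℝ} (hα : 0 < α) {s : ℝ} (hs : 0 ≤ s) : 0 ≤ abelKernel α s :=
  div_nonneg (Real.rpow_nonneg hs _) (Real.Gamma_pos_of_pos hα).le

/-- The upper limit min(τ, t_n) keeps the kernel's argument nonnegative. This sign makes the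
implicit part of the memory term dissipative. -/
theorem weight_self_nonneg {α : ℝ} (hα : 0 < α) {t : ℕ → ℝ} {n : ℕ} (hn : t (n - 1) ≤ t n) :
    0 ≤ weight α t n n := by
  refine mul_nonneg (one_div_nonneg.2 (mul_self_nonneg _)) ?_
  refine intervalIntegral.integral_nonneg hn fun τ hτ => ?_
  refine intervalIntegral.integral_nonneg (le_min hτ.1 hn) fun ζ hζ => ?_
  exact abelKernel_nonneg hα (sub_nonneg.2 (hζ.2.trans (min_le_left _ _)))

/-- The convection term does no work on grid functions that vanish at both ends. -/
theorem sum_convection_mul_eq_zero (h : ℝ) (d : ℕ) (W : ℕ → ℝ) (h0 : W 0 = 0)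
    (hd : W (d + 1) = 0) :
    ∑ i ∈ Finset.range d, threePointMean W (i + 1) * centralDiff h W (i + 1) * W (i + 1) = 0 := by
  -- The three-point mean is what turns the product into an exact difference of the flux W_i W_{i+1}
  -- (W_i + W_{i+1}) / (6h).
  have key : ∀ i, threePointMean W (i + 1) * centralDiff h W (i + 1) * W (i + 1)
      = W (i + 1) * W (i + 1 + 1) * (W (i + 1) + W (i + 1 + 1)) / (6 * h)
        - W i * W (i + 1) * (W i + W (i + 1)) / (6 * h) := by
    intro i
    simp only [threePointMean, centralDiff, Nat.add_sub_cancel]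
    ring
  simp only [key]
  rw [Finset.sum_range_sub (fun i => W i * W (i + 1) * (W i + W (i + 1)) / (6 * h)), h0, hd]
  ring

/-- The second difference is dissipative on grid functions that vanish at both ends. -/
theorem sum_secondDiff_mul_nonpos (h : ℝ) (d : ℕ) (W : ℕ → ℝ) (h0 : W 0 = 0)
    (hd : W (d + 1) = 0) :
    ∑ i ∈ Finset.range d, secondDiff h W (i + 1) * W (i + 1) ≤ 0 := by
  -- Summation by parts, with the square of each backward difference dropped.
  have key : ∀ i ∈ Finset.range d, secondDiff h W (i + 1) * W (i + 1)
      ≤ W (i + 1) * (W (i + 1 + 1) - W (i + 1)) / h ^ 2 - W i * (W (i + 1) - W i) / h ^ 2 := by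
    intro i _
    have : secondDiff h W (i + 1) * W (i + 1)
      = W (i + 1) * (W (i + 1 + 1) - W (i + 1)) / h ^ 2 - W i * (W (i + 1) - W i) / h ^ 2
        - ((W (i + 1) - W i) / h) ^ 2 := by
      simp only [secondDiff, backwardDiff, Nat.add_sub_cancel]
      ring
    rw [this]
    exact sub_le_self _ (sq_nonneg _)
  refine (Finset.sum_le_sum key).trans ?_
  rw [Finset.sum_range_sub (fun i => W i * (W (i + 1) - W i) / h ^ 2), h0, hd]
  have : 0 ≤ (W d / h) ^ 2 := sq_nonneg _
  have h2 : W d * (0 - W d) / h ^ 2 = -(W d / h) ^ 2 := by ring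
  rw [h2]
  simpa using this

/-- The grid function with interior values `V` at the nodes `1, ..., d` and zero elsewhere. -/
def zeroExtend {d : ℕ} (V : EuclideanSpace ℝ (Fin d)) (j : ℕ) : ℝ :=
  if hj : 1 ≤ j ∧ j - 1 < d then V ⟨j - 1, hj.2⟩ else 0

theorem zeroExtend_zero {d : ℕ} (V : EuclideanSpace ℝ (Fin d)) : zeroExtend V 0 = 0 := by
  simp [zeroExtend]

theorem zeroExtend_last {d : ℕ} (V : EuclideanSpace ℝ (Fin d)) : zeroExtend V (d + 1) = 0 := by
  simp [zeroExtend]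

theorem zeroExtend_interior {d : ℕ} (V : EuclideanSpace ℝ (Fin d)) (i : Fin d) :
    zeroExtend V (i + 1) = V i := by
  simp [zeroExtend]

theorem contDiff_zeroExtend {d : ℕ} (j : ℕ) :
    ContDiff ℝ 1 fun V : EuclideanSpace ℝ (Fin d) => zeroExtend V j := by
  unfold zeroExtend
  split_ifs
  · exact contDiff_euclidean.1 contDiff_id _
  · exact contDiff_const

/-- Solvability of the nonlinear system that determines one time level. -/
theorem exists_level {a c : ℝ} (ha : 0 < a) (hc : 0 ≤ c) (h : ℝ) (d : ℕ) (g : ℕ → ℝ) :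
    ∃ W : ℕ → ℝ, W 0 = 0 ∧ W (d + 1) = 0 ∧ ∀ j, 1 ≤ j → j ≤ d →
      a * W j + threePointMean W j * centralDiff h W j = c * secondDiff h W j + g j := by
  let γ : EuclideanSpace ℝ (Fin d) := WithLp.toLp 2 fun i => g (i + 1)
  let F : EuclideanSpace ℝ (Fin d) → EuclideanSpace ℝ (Fin d) := fun V => WithLp.toLp 2 fun i =>
    a * zeroExtend V (i + 1)
      + threePointMean (zeroExtend V) (i + 1) * centralDiff h (zeroExtend V) (i + 1)
      - c * secondDiff h (zeroExtend V) (i + 1) - g (i + 1)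
  have hF : ContDiff ℝ 1 F := by
    refine contDiff_euclidean.2 fun i => ?_
    have hz := fun j => contDiff_zeroExtend (d := d) j
    simp only [F, threePointMean, centralDiff, secondDiff, backwardDiff]
    fun_prop
  have hinner : ∀ V, a * ‖V‖ ^ 2 - ‖γ‖ * ‖V‖ ≤ inner ℝ (F V) V := by
    intro V
    have h1 := sum_convection_mul_eq_zero h d _ (zeroExtend_zero V) (zeroExtend_last V)
    have h2 := sum_secondDiff_mul_nonpos h d _ (zeroExtend_zero V) (zeroExtend_last V)
    have h3 : inner ℝ γ V ≤ ‖γ‖ * ‖V‖ := real_inner_le_norm _ _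
    rw [Finset.sum_range] at h1 h2
    have h4 : inner ℝ (F V) V = a * ‖V‖ ^ 2
        + (∑ i : Fin d, threePointMean (zeroExtend V) (i + 1)
            * centralDiff h (zeroExtend V) (i + 1) * zeroExtend V (i + 1))
        - c * (∑ i : Fin d, secondDiff h (zeroExtend V) (i + 1) * zeroExtend V (i + 1))
        - inner ℝ γ V := by
      rw [← real_inner_self_eq_norm_sq]
      simp only [PiLp.inner_apply, Finset.mul_sum, ← Finset.sum_add_distrib,
        ← Finset.sum_sub_distrib, F, γ, zeroExtend_interior]
      refine Finset.sum_congr rfl fun i _ => ?_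
      simp only [RCLike.inner_apply, conj_trivial]
      ring
    have h5 := mul_nonpos_of_nonneg_of_nonpos hc h2
    rw [h4]
    linarith
  -- Beyond this radius a‖V‖ ≥ ‖γ‖ + a > ‖γ‖, so the lower bound in `hinner` is positive.
  obtain ⟨V, hV⟩ := exists_zero_of_inner_pos hF (‖γ‖ / a + 1) fun V hV => by
    refine lt_of_lt_of_le ?_ (hinner V)
    have h1 : 0 < ‖V‖ := lt_of_lt_of_le (by positivity) hV
    have h2 : ‖γ‖ < a * ‖V‖ := by
      have := mul_le_mul_of_nonneg_left hV ha.le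
      rw [mul_add, mul_div_cancel₀ _ ha.ne'] at this
      linarith
    nlinarith
  refine ⟨zeroExtend V, zeroExtend_zero V, zeroExtend_last V, fun j hj1 hjd => ?_⟩
  obtain ⟨i, rfl⟩ := Nat.exists_eq_add_of_le' hj1
  have h1 := congrArg (fun X : EuclideanSpace ℝ (Fin d) => X ⟨i, hjd⟩) hV
  simp only [F, PiLp.zero_apply] at h1
  linarith

/-! ### Time stepping. -/

theorem discreteFracInt_congr (α : ℝ) (t : ℕ → ℝ) {W W' : ℕ → ℝ} {n : ℕ} (hn : 1 ≤ n)
    (hW : ∀ m ≤ n, W m = W' m) : discreteFracInt α t W n = discreteFracInt α t W' n := by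
  unfold discreteFracInt timeAvg
  rw [hW 1 hn]
  congr 1
  refine Finset.sum_congr rfl fun s hs => ?_
  rw [Finset.mem_Icc] at hs
  rw [hW s hs.2, hW (s - 1) ((Nat.sub_le _ _).trans hs.2)]

theorem discreteFracInt_one (α : ℝ) (t W : ℕ → ℝ) :
    discreteFracInt α t W 1 = weight α t 1 1 * W 1 * timeStep t 1 := by
  simp [discreteFracInt]

theorem discreteFracInt_succ (α : ℝ) (t W : ℕ → ℝ) {m : ℕ} (hm : 1 ≤ m) :
    discreteFracInt α t W (m + 1) = (weight α t (m + 1) 1 * W 1 * timeStep t 1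
      + ∑ s ∈ Finset.Icc 2 m, weight α t (m + 1) s * timeAvg W s * timeStep t s)
      + weight α t (m + 1) (m + 1) * timeAvg W (m + 1) * timeStep t (m + 1) := by
  unfold discreteFracInt
  rw [Finset.sum_Icc_succ_top (by omega), add_assoc]

variable {α h : ℝ} {d m : ℕ} {t : ℕ → ℝ} {f : ℕ → ℕ → ℝ}

theorem exists_isSolution_one (hα : 0 < α) (ht : t 0 < t 1) (U0 : Fin (d + 1 - 1) → ℝ) :
    ∃ U, IsSolution α h (d + 1) 1 t f U0 U := by
  have hk : 0 < timeStep t 1 := sub_pos.2 ht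
  -- The zero boundary values chosen at level 0 are harmless: no equation reads them, since the
  -- first level uses U^0 only in the time difference at interior nodes.
  let u0 : ℕ → ℝ := fun j => zeroExtend (d := d) (WithLp.toLp 2 U0) j
  obtain ⟨W, hW0, hWd, hW⟩ := exists_level (one_div_pos.2 hk)
    (mul_nonneg (weight_self_nonneg (n := 1) hα ht.le) hk.le) h d
    (fun j => f 1 j + u0 j / timeStep t 1)
  refine ⟨fun n => if n = 0 then u0 else W, ?_, ?_, ?_, ?_⟩
  · intro i
    exact zeroExtend_interior (d := d) _ i
  · intro n hn _
    rw [if_neg (by omega)]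
    exact ⟨hW0, hWd⟩
  · intro j hj1 hjd
    have := hW j hj1 hjd
    rw [discreteFracInt_one]
    simp only [timeDiff, if_true, one_ne_zero, if_false, Nat.sub_self]
    linear_combination this
  · intro n hn hn'
    omega

/-- With the midpoint V as unknown, the time difference is (2/k)(V - U^m) and the diagonal memory
term is c δ_x² V, so the step has the form solved by `exists_level` with a = 2/k. -/
theorem IsSolution.exists_succ (hα : 0 < α) (hm : 1 ≤ m) (ht : t m < t (m + 1))
    {U0 : Fin (d + 1 - 1) → ℝ} {U : ℕ → ℕ → ℝ} (hU : IsSolution α h (d + 1) m t f U0 U) :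
    ∃ U', IsSolution α h (d + 1) (m + 1) t f U0 U' := by
  have hk : 0 < timeStep t (m + 1) := sub_pos.2 ht
  -- The part of the memory term already determined by levels up to m.
  let H : ℕ → ℝ := fun j => weight α t (m + 1) 1 * secondDiff h (U 1) j * timeStep t 1
    + ∑ s ∈ Finset.Icc 2 m,
        weight α t (m + 1) s * timeAvg (fun p => secondDiff h (U p) j) s * timeStep t s
  obtain ⟨V, hV0, hVd, hV⟩ := exists_level (div_pos two_pos hk)
    (mul_nonneg (weight_self_nonneg (n := m + 1) hα ht.le) hk.le) h d
    (fun j => H j + f (m + 1) j + 2 / timeStep t (m + 1) * U m j)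
  let U' : ℕ → ℕ → ℝ := fun n => if n ≤ m then U n else fun j => 2 * V j - U m j
  have hold : ∀ n ≤ m, U' n = U n := fun n hn => if_pos hn
  have hnew : U' (m + 1) = fun j => 2 * V j - U m j := if_neg (by omega)
  have havg : ∀ n ≤ m, ∀ j, timeAvg (fun p => U' p j) n = timeAvg (fun p => U p j) n := by
    intro n hn j
    simp only [timeAvg, hold n hn, hold (n - 1) (by omega)]
  have hdiff : ∀ n ≤ m, ∀ j, timeDiff t (fun p => U' p j) n = timeDiff t (fun p => U p j) n := by
    intro n hn j
    simp only [timeDiff, hold n hn, hold (n - 1) (by omega)]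
  have hfrac : ∀ n, 1 ≤ n → n ≤ m → ∀ j, discreteFracInt α t (fun p => secondDiff h (U' p) j) n
      = discreteFracInt α t (fun p => secondDiff h (U p) j) n := fun n hn hnm j =>
    discreteFracInt_congr α t hn fun p hp => by rw [hold p (hp.trans hnm)]
  refine ⟨U', ?_, ?_, ?_, ?_⟩
  · intro i
    rw [hold 0 (Nat.zero_le _)]
    exact hU.initial i
  · intro n hn hnm
    rcases Nat.lt_or_eq_of_le hnm with hlt | rfl
    · rw [hold n (by omega)]
      exact hU.boundary n hn (by omega)
    -- Reflecting V through U^m preserves the zero boundary values only because m ≥ 1; those of U^0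
    -- are not prescribed.
    · obtain ⟨h1, h2⟩ := hU.boundary m hm le_rfl
      rw [hnew]
      exact ⟨by simp only [hV0, h1]; ring, by simp only [hVd, h2]; ring⟩
  · intro j hj1 hjd
    rw [hold 1 hm, hdiff 1 hm, hfrac 1 le_rfl hm]
    exact hU.first_level j hj1 hjd
  · intro n hn hnm j hj1 hjd
    rcases Nat.lt_or_eq_of_le hnm with hlt | rfl
    · have hle : n ≤ m := by omega
      simp only [havg n hle]
      rw [hdiff n hle, hfrac n (by omega) hle]
      exact hU.later_levels n hn hle j hj1 hjd
    · have havgV : (fun i => timeAvg (fun p => U' p i) (m + 1)) = V := by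
        funext i
        simp only [timeAvg, Nat.add_sub_cancel, hold m le_rfl, hnew]
        ring
      have havgD : timeAvg (fun p => secondDiff h (U' p) j) (m + 1) = secondDiff h V j := by
        simp only [timeAvg, Nat.add_sub_cancel, hold m le_rfl, hnew, secondDiff, backwardDiff]
        ring
      have hhist : ∑ s ∈ Finset.Icc 2 m,
          weight α t (m + 1) s * timeAvg (fun p => secondDiff h (U' p) j) s * timeStep t s
          = ∑ s ∈ Finset.Icc 2 m,
          weight α t (m + 1) s * timeAvg (fun p => secondDiff h (U p) j) s * timeStep t s := by
        refine Finset.sum_congr rfl fun s hs => ?_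
        rw [Finset.mem_Icc] at hs
        simp only [timeAvg, hold s hs.2, hold (s - 1) (by omega)]
      rw [havgV, discreteFracInt_succ α t _ hm, havgD, hhist, hold 1 hm]
      have := hV j hj1 hjd
      simp only [timeDiff, Nat.add_sub_cancel, hold m le_rfl, hnew]
      linear_combination this

end PIDEScheme

theorem theorem4p1 (α : ℝ) (hα0 : 0 < α) (hα1 : α < 1) (L : ℝ) (hL : 0 < L)
    (J N : ℕ) (hJ : 1 ≤ J) (hN : 1 ≤ N)
    (t : ℕ → ℝ) (ht0 : t 0 = 0) (ht : ∀ n, n < N → t n < t (n + 1))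
    (f : ℕ → ℕ → ℝ) (U0 : Fin (J - 1) → ℝ) :
    ∃ U : ℕ → ℕ → ℝ, PIDEScheme.IsSolution α (L / J) J N t f U0 U := by
  obtain ⟨d, rfl⟩ := Nat.exists_eq_add_of_le' hJ
  induction N, hN using Nat.le_induction with
  | base => exact PIDEScheme.exists_isSolution_one hα0 (ht 0 one_pos) U0
  | succ m hm ih =>
    obtain ⟨U, hU⟩ := ih fun n hn => ht n (by omega)
    exact hU.exists_succ hα0 hm (ht m (by omega))
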